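/- Let $A\in\mathbb{R}^{m\times n}$ have rank $\rho$, let $1\le k<\rho$, and let $$A=U\begin{pmatrix}\Sigma_1&0\\0&\Sigma_2\end{pmatrix}\begin{pmatrix}V_1^\top\\V_2^\top\end{pmatrix}$$ be a compact singular value decomposition of $A$ (with $U\in\mathbb{R}^{m\times\rho}$ and $(V_1,V_2)\in\mathbb{R}^{n\times\rho}$ having orthonormal columns, positive singular values in descending order, the $k$ largest in $\Sigma_1\in\mathbb{R}^{k\times k}$, the others in $\Sigma_2\in\mathbb{R}^{(\rho-k)\times(\rho-k)}$). Let $s_i^*$ be the squared Euclidean norm of the $i$-th row of $V_1\in\mathbb{R}^{n\times k}$. Let $\mathbf{s}=(s_1,\dots,s_n)$ be non-negative scores with $\sum_{i=1}^n s_i=k$ such that $s_i>0$ whenever $s_i^*>0$, and put $$c(\mathbf{s})=\max_{1\le i\le n}\frac{s_i^*}{s_i},\qquad q(\mathbf{s})=\max_{1\le i\le n}\frac{\sqrt{s_i^*}}{s_i},$$ where $0/0$ is read as $0$. Let $i_1,\dots,i_\ell$ be independent random indices in $\{1,\dots,n\}$, each equal to $i$ with probability $s_i/\sum_{j=1}^n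 s_j$. Let $S\in\mathbb{R}^{n\times\ell}$ be the sampling matrix with $S_{i,j}=1$ if $i=i_j$ and $S_{i,j}=0$ otherwise, let $D\in\mathbb{R}^{\ell\times\ell}$ be the diagonal matrix with $D_{jj}=1/\sqrt{s_{i_j}}$, and let $\Omega=SD$, $\Omega_1=V_1^\top\Omega$, $\Omega_2=V_2^\top\Omega$. Then, for every $\delta\in(0,1)$, with probability at least $1-\delta$, $$\|\Omega_2\Omega_1^\top\|_2\le\sqrt{2c(\mathbf{s})\frac{(\rho+1-k)\,\ell\,\log(\rho/\delta)}{k}}+\frac{2q(\mathbf{s})\log(\rho/\delta)}{3},$$ where $\|\cdot\|_2$ is the spectral norm and $\log$ the natural logarithm. -/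

import Mathlib

open MeasureTheory ProbabilityTheory
-- `‖M‖` for a real matrix `M` is the spectral norm (largest singular value).
open scoped Matrix.Norms.L2Operator

noncomputable section

namespace ColumnSampling

/-- A compact singular value decomposition
`A = U * diag(Σ₁, Σ₂) * [V₁ᵀ; V₂ᵀ]`, with the `k` largest singular values in `Σ₁ = diag σ₁` and
the remaining `r` nonzero ones in `Σ₂ = diag σ₂`, both in descending order. -/
structure IsSVD {m n k r : ℕ} (A : Matrix (Fin m) (Fin n) ℝ)
    (U : Matrix (Fin m) (Fin k ⊕ Fin r) ℝ) (σ₁ : Fin k → ℝ) (σ₂ : Fin r → ℝ)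
    (V₁ : Matrix (Fin n) (Fin k) ℝ) (V₂ : Matrix (Fin n) (Fin r) ℝ) : Prop where
  left_orthonormal : U.transpose * U = 1
  right_orthonormal :
    (Matrix.fromCols V₁ V₂).transpose * Matrix.fromCols V₁ V₂ = 1
  pos₁ : ∀ a, 0 < σ₁ a
  pos₂ : ∀ b, 0 < σ₂ b
  antitone₁ : Antitone σ₁
  antitone₂ : Antitone σ₂
  le : ∀ a b, σ₂ b ≤ σ₁ a
  eq : A = U * Matrix.fromBlocks (Matrix.diagonal σ₁) 0 0 (Matrix.diagonal σ₂) *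
    Matrix.fromRows V₁.transpose V₂.transpose

/-- The sampling matrix `S` of the column indices `idx 0, …, idx (ℓ - 1)`. -/
def samplingMatrix {n ℓ : ℕ} (idx : Fin ℓ → Fin n) : Matrix (Fin n) (Fin ℓ) ℝ :=
  Matrix.of fun i j => if i = idx j then 1 else 0

/-- The diagonal rescaling matrix `D`, with `D j j = 1 / √(s (idx j))`. -/
def rescalingMatrix {n ℓ : ℕ} (s : Fin n → ℝ) (idx : Fin ℓ → Fin n) :
    Matrix (Fin ℓ) (Fin ℓ) ℝ :=
  Matrix.diagonal fun j => 1 / √(s (idx j))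

/-- The sampling-and-rescaling matrix `Ω = S * D`. -/
def sketch {n ℓ : ℕ} (s : Fin n → ℝ) (idx : Fin ℓ → Fin n) : Matrix (Fin n) (Fin ℓ) ℝ :=
  samplingMatrix idx * rescalingMatrix s idx

/-- The statistical leverage score of column `i`: the squared Euclidean norm of row `i` of `V₁`. -/
def leverage {n k : ℕ} (V₁ : Matrix (Fin n) (Fin k) ℝ) (i : Fin n) : ℝ :=
  ‖(WithLp.toLp 2 (V₁ i) : EuclideanSpace ℝ (Fin k))‖ ^ 2

/-- `c(s) = max_i s*_i / s_i`. A column with `s*_i = s_i = 0` counts as `0`. -/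
def cScore {n k : ℕ} (V₁ : Matrix (Fin n) (Fin k) ℝ) (s : Fin n → ℝ) : ℝ :=
  ⨆ i, leverage V₁ i / s i

/-- `q(s) = max_i √(s*_i) / s_i`. A column with `s*_i = s_i = 0` counts as `0`. -/
def qScore {n k : ℕ} (V₁ : Matrix (Fin n) (Fin k) ℝ) (s : Fin n → ℝ) : ℝ :=
  ⨆ i, √(leverage V₁ i) / s i

end ColumnSampling

end

/-!
# A tail bound for the cross term in column sampling

Write `Ω₂ Ω₁ᵀ = ∑ⱼ v₂ v₁ᵀ / s`, where `v₁`, `v₂` and `s` belong to the `j`-th sampled column. The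
summands are i.i.d. with mean `V₂ᵀ V₁ / k = 0`. The spectral norm is at most the Frobenius norm, and
the Frobenius norm makes the matrices a Hilbert space, so that no matrix concentration inequality is
needed: a Bernstein inequality in Hilbert space, whose dimension-free prefactor `2` is at most `ρ`,
gives the bound. A summand has Frobenius norm `√s*ᵢ ‖v₂ᵢ‖ / sᵢ ≤ q(s)`, since the rows of `V₂` have
norm at most one, and the second moment of its Frobenius norm is
`∑ᵢ s*ᵢ ‖v₂ᵢ‖² / (k sᵢ) ≤ c(s) ‖V₂‖_F² / k = c(s) (ρ - k) / k`.

The Hilbert space inequality (`measureReal_norm_sum_ge_le`) goes back to Pinelis. Its core is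
`cosh_norm_add_le`, which bounds `cosh ‖x + y‖` by `cosh ‖x‖ (exp ‖y‖ - ‖y‖)` plus a term linear in
`y`. That term has mean zero for a centred `y` independent of `x`, so
`E cosh ‖∑ Xᵢ‖ ≤ ∏ E (exp ‖Xᵢ‖ - ‖Xᵢ‖)`; Markov's inequality finishes the proof. To prove
`cosh_norm_add_le`, fix `‖x‖` and `‖y‖`: the left side is a convex function of the inner product,
because all coefficients of the power series of `cosh √u` are non-negative, so it suffices to compare
both sides when `y` is parallel to `x`.
-/

/-! ### Pointwise inequalities -/

/-- Convexity of `u ↦ cosh √u = ∑ uⁿ / (2n)!`, term by term in the power series. -/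
theorem cosh_sqrt_convex {u v a b : ℝ} (hu : 0 ≤ u) (hv : 0 ≤ v) (ha : 0 ≤ a) (hb : 0 ≤ b)
    (hab : a + b = 1) :
    Real.cosh √(a * u + b * v) ≤ a * Real.cosh √u + b * Real.cosh √v := by
  refine hasSum_le (fun n => ?_) (Real.hasSum_cosh _)
    (((Real.hasSum_cosh √u).mul_left a).add ((Real.hasSum_cosh √v).mul_left b))
  rw [pow_mul, pow_mul, pow_mul, Real.sq_sqrt (by positivity), Real.sq_sqrt hu, Real.sq_sqrt hv,
    ← mul_div_assoc, ← mul_div_assoc, ← add_div]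
  gcongr
  simpa using (convexOn_pow n).2 hu hv ha hb hab

/-- `cosh_norm_add_le` for vectors of norms `a` and `b` at an angle of cosine `c`. -/
theorem cosh_add_mul_le {a b : ℝ} (ha : 0 ≤ a) (hb : 0 ≤ b) {c : ℝ} (hc : |c| ≤ 1) :
    Real.cosh √(a ^ 2 + 2 * (a * b * c) + b ^ 2) ≤
      Real.cosh a * (Real.exp b - b) + Real.sinh a * (b * c) := by
  obtain ⟨h1, h2⟩ := abs_le.1 hc
  -- Interpolate between the parallel case `c = 1` and the antiparallel case `c = -1`.
  have key := cosh_sqrt_convex (sq_nonneg (a + b)) (sq_nonneg (a - b))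
    (a := (1 + c) / 2) (b := (1 - c) / 2) (by linarith) (by linarith) (by ring)
  rw [Real.sqrt_sq_eq_abs, Real.sqrt_sq_eq_abs, Real.cosh_abs, Real.cosh_abs,
    Real.cosh_add, Real.cosh_sub] at key
  rw [show a ^ 2 + 2 * (a * b * c) + b ^ 2 =
    (1 + c) / 2 * (a + b) ^ 2 + (1 - c) / 2 * (a - b) ^ 2 by ring]
  refine key.trans ?_
  have hs : 0 ≤ Real.sinh b - b := sub_nonneg.2 (Real.self_le_sinh_iff.2 hb)
  have hsc : c * Real.sinh a ≤ Real.cosh a := by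
    have := Real.sinh_lt_cosh a
    have := Real.sinh_nonneg_iff.2 ha
    nlinarith
  rw [← Real.cosh_add_sinh b]
  nlinarith [mul_nonneg hs (sub_nonneg.2 hsc)]

/-- The series of `exp x - 1 - x` is dominated by a geometric one, since `(n + 2)! ≥ 2 * 3 ^ n`. -/
theorem exp_sub_le_of_le {x R : ℝ} (hx : 0 ≤ x) (hxR : x ≤ R) (hR : R < 3) :
    Real.exp x - x ≤ 1 + x ^ 2 / (2 * (1 - R / 3)) := by
  have h := NormedSpace.expSeries_div_hasSum_exp (𝔸 := ℝ) x
  rw [← Real.exp_eq_exp_ℝ] at h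
  have h2 := (hasSum_nat_add_iff' 2).2 h
  have hg := (hasSum_geometric_of_lt_one (r := R / 3) (by linarith) (by linarith)).mul_left
    (x ^ 2 / 2)
  have hfac : ∀ n : ℕ, 2 * 3 ^ n ≤ (n + 2).factorial := fun n =>
    Nat.factorial_mul_pow_le_factorial (m := 2) |>.trans_eq (by rw [add_comm])
  have := hasSum_le (fun n => ?_) h2 hg
  · simp [Finset.sum_range_succ] at this
    rw [div_mul_eq_div_div, div_eq_mul_inv (x ^ 2 / 2)]
    linarith
  · have h3 : (2 * 3 ^ n : ℝ) ≤ ((n + 2).factorial : ℝ) := by exact_mod_cast hfac n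
    calc x ^ (n + 2) / ((n + 2).factorial : ℝ) ≤ (x ^ 2 * R ^ n) / (2 * 3 ^ n) := by
          have : 0 ≤ R := hx.trans hxR
          rw [pow_add, mul_comm]
          gcongr
      _ = _ := by rw [div_pow]; field_simp

section CoshBounds

variable {E : Type*} [NormedAddCommGroup E] [InnerProductSpace ℝ E]

/-- A second-order expansion of `cosh ‖·‖` at `x`. The gradient `(sinh ‖x‖ / ‖x‖) • x` is `0` at
`x = 0` by the convention for division by zero, which is the correct value. -/
theorem cosh_norm_add_le (x y : E) :
    Real.cosh ‖x + y‖ ≤ Real.cosh ‖x‖ * (Real.exp ‖y‖ - ‖y‖) +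
      inner ℝ ((Real.sinh ‖x‖ / ‖x‖) • x) y := by
  have h := cosh_add_mul_le (norm_nonneg x) (norm_nonneg y)
    (abs_real_inner_div_norm_mul_norm_le_one x y)
  have e : ‖x‖ * ‖y‖ * (inner ℝ x y / (‖x‖ * ‖y‖)) = inner ℝ x y := by
    rcases eq_or_ne x 0 with rfl | hx
    · simp
    rcases eq_or_ne y 0 with rfl | hy
    · simp
    field_simp
  rw [e, ← norm_add_sq_real, Real.sqrt_sq (norm_nonneg _)] at h
  refine h.trans_eq ?_
  rw [real_inner_smul_left]
  congr 1
  rcases eq_or_ne y 0 with rfl | hy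
  · simp
  field_simp

end CoshBounds

/-! ### Bernstein's inequality in Hilbert space -/

section Bernstein

variable {E : Type*} [NormedAddCommGroup E] [InnerProductSpace ℝ E]
  [MeasurableSpace E] [BorelSpace E]
  {Γ : Type*} [MeasurableSpace Γ] {μ : Measure Γ} [IsProbabilityMeasure μ]

omit [InnerProductSpace ℝ E] in
theorem integrable_comp_norm_of_norm_le {X : Γ → E} (hX : Measurable X) {C : ℝ}
    (hC : ∀ ω, ‖X ω‖ ≤ C) {f : ℝ → ℝ} (hf : Continuous f) : Integrable (fun ω => f ‖X ω‖) μ := by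
  obtain ⟨K, hK⟩ := (isCompact_Icc (a := 0) (b := C)).exists_bound_of_continuousOn hf.continuousOn
  exact .of_bound (hf.measurable.comp hX.norm).aestronglyMeasurable K
    (ae_of_all _ fun ω => hK _ ⟨norm_nonneg _, hC ω⟩)

variable [CompleteSpace E] [SecondCountableTopology E]

/-- One step of the exponential moment bound: adding an independent centred summand. -/
theorem integral_cosh_norm_add_le {S X : Γ → E} (hS : Measurable S) (hX : Measurable X)
    {C R : ℝ} (hSC : ∀ ω, ‖S ω‖ ≤ C) (hXR : ∀ ω, ‖X ω‖ ≤ R) (hind : IndepFun S X μ)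
    (hmean : ∫ ω, X ω ∂μ = 0) :
    ∫ ω, Real.cosh ‖S ω + X ω‖ ∂μ ≤
      (∫ ω, Real.cosh ‖S ω‖ ∂μ) * ∫ ω, (Real.exp ‖X ω‖ - ‖X ω‖) ∂μ := by
  set g : E → E := fun x => (Real.sinh ‖x‖ / ‖x‖) • x with hg
  have hgm : Measurable g := by
    have := Real.continuous_sinh.measurable
    fun_prop
  have hgn : ∀ x, ‖g x‖ = Real.sinh ‖x‖ := fun x => by
    rcases eq_or_ne x 0 with rfl | hx
    · simp [hg]
    · have := Real.sinh_nonneg_iff.2 (norm_nonneg x)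
      rw [hg, norm_smul, Real.norm_of_nonneg (by positivity)]
      field_simp
  have hgi : Integrable (g ∘ S) μ :=
    .of_bound (hgm.comp hS).aestronglyMeasurable (Real.sinh C) (ae_of_all _ fun ω => by
      rw [Function.comp, hgn]; exact Real.sinh_le_sinh.2 (hSC ω))
  have hXi : Integrable X μ := .of_bound hX.aestronglyMeasurable R (ae_of_all _ hXR)
  let B := (isBoundedBilinearMap_inner (𝕜 := ℝ) (E := E)).toContinuousLinearMap
  have hind' : IndepFun (g ∘ S) X μ := hind.comp hgm measurable_id
  -- The linear term of `cosh_norm_add_le` averages out.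
  have hcross : ∫ ω, inner ℝ (g (S ω)) (X ω) ∂μ = 0 := by
    have := hind'.integral_bilin hgi hXi B
    rwa [hmean, map_zero] at this
  have hcrossi : Integrable (fun ω => inner ℝ (g (S ω)) (X ω)) μ :=
    hind'.integrable_bilin hgi hXi B
  have hcosh := integrable_comp_norm_of_norm_le (μ := μ) hS hSC Real.continuous_cosh
  have hexp := integrable_comp_norm_of_norm_le (μ := μ) hX hXR
    (f := fun t => Real.exp t - t) (by fun_prop)
  have hind'' : IndepFun (fun ω => Real.cosh ‖S ω‖) (fun ω => Real.exp ‖X ω‖ - ‖X ω‖) μ :=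
    hind.comp (φ := fun x => Real.cosh ‖x‖) (ψ := fun x => Real.exp ‖x‖ - ‖x‖)
      (Real.continuous_cosh.measurable.comp measurable_norm) (by fun_prop)
  have hprod := hind''.integral_fun_mul_eq_mul_integral hcosh.1 hexp.1
  have hprodi : Integrable (fun ω => Real.cosh ‖S ω‖ * (Real.exp ‖X ω‖ - ‖X ω‖)) μ :=
    hind''.integrable_mul hcosh hexp
  rw [← hprod, ← add_zero (∫ ω, _ * _ ∂μ), ← hcross, ← integral_add hprodi hcrossi]
  refine integral_mono ?_ (hprodi.add hcrossi) fun ω => cosh_norm_add_le _ _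
  exact integrable_comp_norm_of_norm_le (hS.add hX) (C := C + R)
    (fun ω => (norm_add_le _ _).trans (add_le_add (hSC ω) (hXR ω))) Real.continuous_cosh

theorem integral_cosh_norm_sum_le {ι : Type*} {X : ι → Γ → E} (hX : ∀ i, Measurable (X i))
    (hind : iIndepFun X μ) {R : ℝ} (hXR : ∀ i ω, ‖X i ω‖ ≤ R) (hmean : ∀ i, ∫ ω, X i ω ∂μ = 0)
    (s : Finset ι) :
    ∫ ω, Real.cosh ‖∑ i ∈ s, X i ω‖ ∂μ ≤
      ∏ i ∈ s, ∫ ω, (Real.exp ‖X i ω‖ - ‖X i ω‖) ∂μ := by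
  classical
  induction s using Finset.induction_on with
  | empty => simp
  | insert i s hi ih =>
    have hindi : IndepFun (fun ω => ∑ j ∈ s, X j ω) (X i) μ := by
      simpa only [Finset.sum_fn] using hind.indepFun_finsetSum_of_notMem hX hi
    have h := integral_cosh_norm_add_le (Finset.measurable_fun_sum s fun j _ => hX j) (hX i)
      (fun ω => norm_sum_le_of_le s fun j _ => hXR j ω) (hXR i) hindi (hmean i)
    simp only [Finset.sum_insert hi, Finset.prod_insert hi, add_comm (X i _)]
    rw [mul_comm]
    refine h.trans (mul_le_mul_of_nonneg_right ih (integral_nonneg fun ω => ?_))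
    have := Real.add_one_le_exp ‖X i ω‖
    simp only [Pi.zero_apply]
    linarith

/-- Bernstein's inequality in a Hilbert space, solved for the deviation at level `2 * exp (-L)`. The
prefactor does not depend on the dimension. -/
theorem measureReal_norm_sum_ge_le {ι : Type*} [Fintype ι] {X : ι → Γ → E}
    (hX : ∀ i, Measurable (X i)) (hind : iIndepFun X μ) {R v L : ℝ} (hR : 0 < R) (hv : 0 ≤ v)
    (hL : 0 < L) (hXR : ∀ i ω, ‖X i ω‖ ≤ R) (hmean : ∀ i, ∫ ω, X i ω ∂μ = 0)
    (hvar : ∑ i, ∫ ω, ‖X i ω‖ ^ 2 ∂μ ≤ v) :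
    μ.real {ω | √(2 * v * L) + 2 * R * L / 3 ≤ ‖∑ i, X i ω‖} ≤ 2 * Real.exp (-L) := by
  -- The exponent is `t = (√(v / (2 L)) + 2 R / 3)⁻¹`. Doubling the optimal `R / 3` keeps
  -- `1 - t R / 3` positive even when `v = 0`; it is paid for by the term `2 R L / 3`.
  set r : ℝ := √(2 * v * L) / (2 * L) with hr
  have hr0 : 0 ≤ r := by positivity
  have hrv : v = 2 * L * r ^ 2 := by
    rw [hr, div_pow, Real.sq_sqrt (by positivity)]; field_simp
  have hrs : √(2 * v * L) = 2 * L * r := by rw [hr]; field_simp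
  set t : ℝ := (r + 2 * R / 3)⁻¹ with ht
  have ht0 : 0 < t := by positivity
  have htr : t * (r + 2 * R / 3) = 1 := inv_mul_cancel₀ (by positivity)
  have htR : t * R < 3 := by nlinarith
  have hdt : 1 - t * R / 3 = t * (r + R / 3) := by linarith
  have hd : 0 < 1 - t * R / 3 := by rw [hdt]; positivity
  have hmgf : ∫ ω, Real.cosh (t * ‖∑ i, X i ω‖) ∂μ ≤ Real.exp (t * (L * r)) := by
    have hind' : iIndepFun (fun i ω => t • X i ω) μ :=
      hind.comp (fun _ x => t • x) fun _ => measurable_const_smul t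
    have h := integral_cosh_norm_sum_le (fun i => (hX i).const_smul t) hind' (R := t * R)
      (fun i ω => by
        rw [Pi.smul_apply, norm_smul, Real.norm_of_nonneg ht0.le]
        exact mul_le_mul_of_nonneg_left (hXR i ω) ht0.le)
      (fun i => by simp only [Pi.smul_apply]; rw [integral_smul, hmean, smul_zero]) Finset.univ
    simp only [Pi.smul_apply, ← Finset.smul_sum, norm_smul, Real.norm_of_nonneg ht0.le] at h
    refine h.trans ?_
    have hfac : ∀ i, ∫ ω, (Real.exp (t * ‖X i ω‖) - t * ‖X i ω‖) ∂μ ≤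
        Real.exp (t ^ 2 / (2 * (1 - t * R / 3)) * ∫ ω, ‖X i ω‖ ^ 2 ∂μ) := fun i => by
      have hsq := integrable_comp_norm_of_norm_le (μ := μ) (hX i) (hXR i) (f := fun x => x ^ 2)
        (by fun_prop)
      calc _ ≤ ∫ ω, (1 + t ^ 2 / (2 * (1 - t * R / 3)) * ‖X i ω‖ ^ 2) ∂μ := by
            refine integral_mono (integrable_comp_norm_of_norm_le (hX i) (hXR i)
              (f := fun x => Real.exp (t * x) - t * x) (by fun_prop))
              ((integrable_const _).add (hsq.const_mul _)) fun ω => ?_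
            have := exp_sub_le_of_le (x := t * ‖X i ω‖) (by positivity)
              (mul_le_mul_of_nonneg_left (hXR i ω) ht0.le) htR
            rwa [mul_pow, mul_div_right_comm] at this
        _ = t ^ 2 / (2 * (1 - t * R / 3)) * ∫ ω, ‖X i ω‖ ^ 2 ∂μ + 1 := by
            rw [integral_add (integrable_const _) (hsq.const_mul _), integral_const_mul]
            simp [add_comm]
        _ ≤ _ := Real.add_one_le_exp _
    refine (Finset.prod_le_prod (fun i _ => integral_nonneg fun ω => ?_) fun i _ => hfac i).trans ?_
    · have := Real.add_one_le_exp (t * ‖X i ω‖)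
      simp only [Pi.zero_apply]
      linarith
    rw [← Real.exp_sum, ← Finset.mul_sum, Real.exp_le_exp]
    refine (mul_le_mul_of_nonneg_left hvar (by positivity)).trans ?_
    rw [div_mul_eq_mul_div, div_le_iff₀ (by positivity), hdt, hrv]
    have : 0 ≤ t ^ 2 * L * r * R := by positivity
    nlinarith
  have hm : Measurable fun ω => ∑ i, X i ω := Finset.measurable_fun_sum _ fun i _ => hX i
  have hmark := mul_meas_ge_le_integral_of_nonneg (μ := μ)
    (f := fun ω => Real.cosh (t * ‖∑ i, X i ω‖)) (ae_of_all _ fun ω => (Real.cosh_pos _).le)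
    (integrable_comp_norm_of_norm_le hm (fun ω => norm_sum_le_of_le _ fun j _ => hXR j ω)
      (f := fun x => Real.cosh (t * x)) (Real.continuous_cosh.comp (by fun_prop)))
    (Real.exp (t * (√(2 * v * L) + 2 * R * L / 3)) / 2)
  have hsub : μ.real {ω | √(2 * v * L) + 2 * R * L / 3 ≤ ‖∑ i, X i ω‖} ≤
      μ.real {ω | Real.exp (t * (√(2 * v * L) + 2 * R * L / 3)) / 2 ≤
        Real.cosh (t * ‖∑ i, X i ω‖)} := by
    refine measureReal_mono (Set.ofPred_subset_ofPred.2 fun ω hω => ?_)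
    have h1 := Real.exp_le_exp.2 (mul_le_mul_of_nonneg_left hω ht0.le)
    have h2 := Real.exp_pos (-(t * ‖∑ i, X i ω‖))
    rw [Real.cosh_eq]
    linarith
  have hexp : t * (L * r) = t * (√(2 * v * L) + 2 * R * L / 3) + -L := by
    rw [hrs]; linear_combination (-L) * htr
  rw [hexp, Real.exp_add] at hmgf
  have hpos := Real.exp_pos (t * (√(2 * v * L) + 2 * R * L / 3))
  refine hsub.trans (le_of_mul_le_mul_left ?_ hpos)
  linarith

end Bernstein

/-! ### Spectral norm, orthonormal columns and finite laws -/

/-- The spectral norm is at most the Frobenius norm. The latter is the Euclidean norm of the vector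
of entries. -/
theorem l2_opNorm_le_norm_of_entries {m n : Type*} [Fintype m] [Fintype n] [DecidableEq n]
    (M : Matrix m n ℝ) (x : EuclideanSpace ℝ (m × n)) (hx : ∀ p, x p = M p.1 p.2) :
    ‖M‖ ≤ ‖x‖ := by
  rw [Matrix.l2_opNorm_def]
  refine ContinuousLinearMap.opNorm_le_bound _ (norm_nonneg _) fun y => ?_
  refine (sq_le_sq₀ (by positivity) (by positivity)).1 ?_
  rw [mul_pow, EuclideanSpace.real_norm_sq_eq, EuclideanSpace.real_norm_sq_eq,
    EuclideanSpace.real_norm_sq_eq, Fintype.sum_prod_type, Finset.sum_mul]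
  refine Finset.sum_le_sum fun i _ => ?_
  simp only [hx]
  exact Finset.sum_mul_sq_le_sq_mul_sq _ _ _

theorem integral_comp_eq_sum {α : Type*} [Fintype α] [MeasurableSpace α]
    [MeasurableSingletonClass α] {F : Type*} [NormedAddCommGroup F] [NormedSpace ℝ F]
    [CompleteSpace F] {Γ : Type*} [MeasurableSpace Γ] {μ : Measure Γ} [IsProbabilityMeasure μ]
    {X : Γ → α} (hX : Measurable X) (g : α → F) :
    ∫ ω, g (X ω) ∂μ = ∑ i, μ.real {ω | X ω = i} • g i := by
  have := Measure.isProbabilityMeasure_map (μ := μ) hX.aemeasurable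
  rw [← integral_map hX.aemeasurable (f := g) (.of_discrete), integral_fintype (.of_finite)]
  refine Finset.sum_congr rfl fun i _ => ?_
  rw [map_measureReal_apply hX (measurableSet_singleton i)]
  rfl

/-- Rows of a matrix with orthonormal columns have norm at most one: for a diagonal entry `p` of the
projection `W * Wᵀ`, which is a sum of squares including `p²`, one has `p² ≤ p`. -/
theorem sum_sq_row_le_one {n r : Type*} [Fintype n] [Fintype r] [DecidableEq r]
    {W : Matrix n r ℝ} (hW : W.transpose * W = 1) (i : n) : ∑ b, W i b ^ 2 ≤ 1 := by
  have hP : W * W.transpose * (W * W.transpose) = W * W.transpose := by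
    rw [Matrix.mul_assoc, ← Matrix.mul_assoc W.transpose, hW, Matrix.one_mul]
  have hd : (W * W.transpose) i i = ∑ b, W i b ^ 2 := by
    simp [Matrix.mul_apply, sq]
  have h := congrFun (congrFun hP i) i
  rw [Matrix.mul_apply] at h
  have hs : ∀ j, (W * W.transpose) j i = (W * W.transpose) i j := fun j => by
    simp [Matrix.mul_apply, mul_comm]
  simp only [hs, ← sq] at h
  have := Finset.single_le_sum (f := fun j => (W * W.transpose) i j ^ 2)
    (fun j _ => sq_nonneg _) (Finset.mem_univ i)
  beta_reduce at this
  rw [h, hd] at this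
  nlinarith

/-! ### Sampled columns -/

namespace ColumnSampling

theorem leverage_eq {n k : ℕ} (V₁ : Matrix (Fin n) (Fin k) ℝ) (i : Fin n) :
    leverage V₁ i = ∑ a, V₁ i a ^ 2 := by
  rw [leverage, EuclideanSpace.real_norm_sq_eq]

theorem leverage_nonneg {n k : ℕ} (V₁ : Matrix (Fin n) (Fin k) ℝ) (i : Fin n) :
    0 ≤ leverage V₁ i := sq_nonneg _

theorem eq_zero_of_leverage_eq_zero {n k : ℕ} {V₁ : Matrix (Fin n) (Fin k) ℝ} {i : Fin n}
    (h : leverage V₁ i = 0) (a : Fin k) : V₁ i a = 0 := by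
  rw [leverage_eq, Finset.sum_eq_zero_iff_of_nonneg fun _ _ => sq_nonneg _] at h
  simpa using h a (Finset.mem_univ a)

theorem leverage_div_le_cScore {n k : ℕ} (V₁ : Matrix (Fin n) (Fin k) ℝ) (s : Fin n → ℝ)
    (i : Fin n) : leverage V₁ i / s i ≤ cScore V₁ s :=
  le_ciSup (f := fun i => leverage V₁ i / s i) (Set.finite_range _).bddAbove i

theorem sqrt_leverage_div_le_qScore {n k : ℕ} (V₁ : Matrix (Fin n) (Fin k) ℝ) (s : Fin n → ℝ)
    (i : Fin n) : √(leverage V₁ i) / s i ≤ qScore V₁ s :=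
  le_ciSup (f := fun i => √(leverage V₁ i) / s i) (Set.finite_range _).bddAbove i

theorem sketch_mul_transpose_apply {n k r ℓ : ℕ} (V₁ : Matrix (Fin n) (Fin k) ℝ)
    (V₂ : Matrix (Fin n) (Fin r) ℝ) {s : Fin n → ℝ} (hs : ∀ i, 0 ≤ s i) (idx : Fin ℓ → Fin n)
    (b : Fin r) (a : Fin k) :
    ((V₂.transpose * sketch s idx) * (V₁.transpose * sketch s idx).transpose) b a =
      ∑ j, V₂ (idx j) b * V₁ (idx j) a / s (idx j) := by
  have h : ∀ {p : ℕ} (V : Matrix (Fin n) (Fin p) ℝ) (c : Fin p) (j : Fin ℓ),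
      (V.transpose * sketch s idx) c j = V (idx j) c / √(s (idx j)) := fun V c j => by
    rw [sketch, rescalingMatrix, ← Matrix.mul_assoc, Matrix.mul_diagonal, Matrix.mul_apply]
    simp [samplingMatrix, div_eq_mul_inv]
  rw [Matrix.mul_apply]
  refine Finset.sum_congr rfl fun j _ => ?_
  rw [Matrix.transpose_apply, h, h, div_mul_div_comm, Real.mul_self_sqrt (hs _)]

/-- The contribution `v₂ᵢ v₁ᵢᵀ / sᵢ` of column `i` to `Ω₂ Ω₁ᵀ`, where `v₁ᵢ` and `v₂ᵢ` are the `i`-th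
rows of `V₁` and `V₂`. It is a vector of `EuclideanSpace` on the pairs of indices, so that its norm
is the Frobenius norm. -/
noncomputable def contribution {n k r : ℕ} (V₁ : Matrix (Fin n) (Fin k) ℝ)
    (V₂ : Matrix (Fin n) (Fin r) ℝ) (s : Fin n → ℝ) (i : Fin n) : EuclideanSpace ℝ (Fin r × Fin k) :=
  WithLp.toLp 2 fun p => V₂ i p.1 * V₁ i p.2 / s i

theorem norm_contribution_sq {n k r : ℕ} (V₁ : Matrix (Fin n) (Fin k) ℝ)
    (V₂ : Matrix (Fin n) (Fin r) ℝ) (s : Fin n → ℝ) (i : Fin n) :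
    ‖contribution V₁ V₂ s i‖ ^ 2 = (∑ b, V₂ i b ^ 2) * leverage V₁ i / s i ^ 2 := by
  rw [EuclideanSpace.real_norm_sq_eq, leverage_eq, Finset.sum_mul_sum, Fintype.sum_prod_type]
  simp only [contribution, div_pow, mul_pow, Finset.sum_div]

theorem norm_contribution_le_qScore {n k r : ℕ} (V₁ : Matrix (Fin n) (Fin k) ℝ)
    {V₂ : Matrix (Fin n) (Fin r) ℝ} (hV₂ : V₂.transpose * V₂ = 1) {s : Fin n → ℝ}
    (hs : ∀ i, 0 ≤ s i) (i : Fin n) : ‖contribution V₁ V₂ s i‖ ≤ qScore V₁ s := by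
  refine le_trans ?_ (sqrt_leverage_div_le_qScore V₁ s i)
  refine (sq_le_sq₀ (norm_nonneg _) (div_nonneg (Real.sqrt_nonneg _) (hs i))).1 ?_
  rw [norm_contribution_sq, div_pow, Real.sq_sqrt (leverage_nonneg V₁ i)]
  gcongr
  exact mul_le_of_le_one_left (leverage_nonneg V₁ i) (sum_sq_row_le_one hV₂ i)

/-- The sampled contribution is centred. Columns that are never sampled do not matter, because their
leverage score is zero. -/
theorem sum_smul_contribution_eq_zero {n k r : ℕ} {V₁ : Matrix (Fin n) (Fin k) ℝ}
    {V₂ : Matrix (Fin n) (Fin r) ℝ} (hV : V₂.transpose * V₁ = 0) {s : Fin n → ℝ}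
    (hs0 : ∀ i, s i = 0 → leverage V₁ i = 0) (c : ℝ) :
    ∑ i, (s i / c) • contribution V₁ V₂ s i = 0 := by
  ext ⟨b, a⟩
  have h := congrFun (congrFun hV b) a
  rw [Matrix.mul_apply] at h
  simp only [WithLp.ofLp_sum, WithLp.ofLp_smul, Finset.sum_apply, Pi.smul_apply, contribution,
    smul_eq_mul, WithLp.ofLp_zero, Pi.zero_apply]
  calc _ = ∑ i, c⁻¹ * (V₂.transpose b i * V₁ i a) := Finset.sum_congr rfl fun i _ => by
        by_cases hi : s i = 0
        · simp [eq_zero_of_leverage_eq_zero (hs0 i hi) a]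
        · simp only [Matrix.transpose_apply]; field_simp
    _ = 0 := by rw [← Finset.mul_sum, h]; simp

/-- The second moment of the sampled contribution in Frobenius norm. -/
theorem sum_mul_norm_contribution_sq_le {n k r : ℕ} (V₁ : Matrix (Fin n) (Fin k) ℝ)
    {V₂ : Matrix (Fin n) (Fin r) ℝ} (hV₂ : V₂.transpose * V₂ = 1) {s : Fin n → ℝ}
    (hs : ∀ i, 0 ≤ s i) (hc : 0 ≤ cScore V₁ s) {c : ℝ} (hc0 : 0 ≤ c) :
    ∑ i, s i / c * ‖contribution V₁ V₂ s i‖ ^ 2 ≤ cScore V₁ s * (r / c) := by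
  have htr : ∑ i, ∑ b, V₂ i b ^ 2 = r := by
    have := congrArg Matrix.trace hV₂
    simp only [Matrix.trace, Matrix.diag, Matrix.mul_apply, Matrix.transpose_apply, ← sq] at this
    rw [Finset.sum_comm, this]
    simp
  rw [← htr, Finset.sum_div, Finset.mul_sum]
  refine Finset.sum_le_sum fun i _ => ?_
  rw [norm_contribution_sq]
  have hb : 0 ≤ (∑ b, V₂ i b ^ 2) / c := div_nonneg (Finset.sum_nonneg fun _ _ => sq_nonneg _) hc0
  -- For `s i = 0` the left side is `0` through the factor `s i / c`.
  rcases (hs i).eq_or_lt with hi | hi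
  · rw [← hi]; simpa using mul_nonneg hc hb
  · refine le_trans (le_of_eq ?_) (mul_le_mul_of_nonneg_right (leverage_div_le_cScore V₁ s i) hb)
    field_simp

theorem exists_leverage_pos {n k : ℕ} (hk : 0 < k) {V₁ : Matrix (Fin n) (Fin k) ℝ}
    (hV₁ : V₁.transpose * V₁ = 1) : ∃ i, 0 < leverage V₁ i := by
  by_contra! h
  have h0 := congrFun (congrFun hV₁ ⟨0, hk⟩) ⟨0, hk⟩
  rw [Matrix.mul_apply, Matrix.one_apply_eq, Finset.sum_eq_zero fun i _ => by
    rw [eq_zero_of_leverage_eq_zero ((h i).antisymm (leverage_nonneg V₁ i)), mul_zero]] at h0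
  exact zero_ne_one h0

end ColumnSampling

open ColumnSampling in
theorem mainTheorem4 {m n k ρ ℓ : ℕ} (hk : 0 < k) (hkρ : k < ρ)
    (A : Matrix (Fin m) (Fin n) ℝ) (hA : A.rank = ρ)
    (U : Matrix (Fin m) (Fin k ⊕ Fin (ρ - k)) ℝ) (σ₁ : Fin k → ℝ) (σ₂ : Fin (ρ - k) → ℝ)
    (V₁ : Matrix (Fin n) (Fin k) ℝ) (V₂ : Matrix (Fin n) (Fin (ρ - k)) ℝ)
    (hSVD : ColumnSampling.IsSVD A U σ₁ σ₂ V₁ V₂)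
    (s : Fin n → ℝ) (hs : ∀ i, 0 ≤ s i) (hsum : ∑ i, s i = k)
    (hs0 : ∀ i, s i = 0 → ColumnSampling.leverage V₁ i = 0)
    {Γ : Type*} [MeasurableSpace Γ] (μ : Measure Γ) [IsProbabilityMeasure μ]
    (idx : Fin ℓ → Γ → Fin n) (hmeas : ∀ j, Measurable (idx j)) (hindep : iIndepFun idx μ)
    (hlaw : ∀ j i, μ.real {ω | idx j ω = i} = s i / ∑ i', s i')
    (δ : ℝ) (hδ : 0 < δ) (hδ1 : δ < 1) :
    1 - δ ≤ μ.real {ω |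
      ‖(V₂.transpose * ColumnSampling.sketch s (fun j => idx j ω)) *
          (V₁.transpose * ColumnSampling.sketch s (fun j => idx j ω)).transpose‖ ≤
        √(2 * ColumnSampling.cScore V₁ s *
            (((ρ : ℝ) + 1 - k) * ℓ * Real.log (ρ / δ) / k)) +
          2 * ColumnSampling.qScore V₁ s * Real.log (ρ / δ) / 3} := by
  have hV := hSVD.right_orthonormal
  rw [Matrix.transpose_fromCols, Matrix.fromRows_mul_fromCols, ← Matrix.fromBlocks_one,
    Matrix.fromBlocks_inj] at hV
  obtain ⟨hV₁, -, hV₂₁, hV₂⟩ := hV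
  obtain ⟨i₀, hi₀⟩ := exists_leverage_pos hk hV₁
  have hsi₀ : 0 < s i₀ := (hs i₀).lt_of_ne fun h => hi₀.ne' (hs0 i₀ h.symm)
  have hq : 0 < qScore V₁ s :=
    (div_pos (Real.sqrt_pos.2 hi₀) hsi₀).trans_le (sqrt_leverage_div_le_qScore V₁ s i₀)
  have hc : 0 < cScore V₁ s := (div_pos hi₀ hsi₀).trans_le (leverage_div_le_cScore V₁ s i₀)
  have hk' : (0 : ℝ) < k := by exact_mod_cast hk
  have hρk : (k : ℝ) < ρ := by exact_mod_cast hkρ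
  have hρ2 : (2 : ℝ) ≤ ρ := by exact_mod_cast (by omega : 2 ≤ ρ)
  have hL : 0 < Real.log (ρ / δ) := Real.log_pos ((one_lt_div hδ).2 (by linarith))
  set X : Fin ℓ → Γ → EuclideanSpace ℝ (Fin (ρ - k) × Fin k) :=
    fun j ω => contribution V₁ V₂ s (idx j ω) with hXdef
  have hvar : ∀ j, ∫ ω, ‖X j ω‖ ^ 2 ∂μ ≤ cScore V₁ s * ((ρ + 1 - k) / k) := fun j => by
    rw [integral_comp_eq_sum (hmeas j) fun i => ‖contribution V₁ V₂ s i‖ ^ 2]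
    simp only [hlaw, hsum, smul_eq_mul]
    refine (sum_mul_norm_contribution_sq_le V₁ hV₂ hs hc.le hk'.le).trans ?_
    rw [Nat.cast_sub hkρ.le]
    gcongr
    linarith
  have hXm : ∀ j, Measurable (X j) := fun j =>
    (measurable_of_finite (contribution V₁ V₂ s)).comp (hmeas j)
  have htail := measureReal_norm_sum_ge_le (μ := μ) (X := X)
    (v := ℓ * (cScore V₁ s * ((ρ + 1 - k) / k)))
    hXm
    (hindep.comp (fun _ => contribution V₁ V₂ s) fun _ => measurable_of_finite _) hq
    (by have : 0 < (ρ : ℝ) + 1 - k := by linarith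
        positivity) hL
    (fun j ω => norm_contribution_le_qScore V₁ hV₂ hs _)
    (fun j => by
      rw [integral_comp_eq_sum (hmeas j)]
      simp only [hlaw, hsum]
      exact sum_smul_contribution_eq_zero hV₂₁ hs0 _)
    ((Finset.sum_le_sum fun j _ => hvar j).trans (by simp))
  -- The prefactor `2` is absorbed by `ρ ≥ 2`.
  have hδ' : 2 * Real.exp (-Real.log (ρ / δ)) ≤ δ := by
    rw [Real.exp_neg, Real.exp_log (by positivity), inv_div, mul_div_assoc',
      div_le_iff₀ (by linarith)]
    nlinarith
  rw [show 2 * (ℓ * (cScore V₁ s * (((ρ : ℝ) + 1 - k) / k))) * Real.log (ρ / δ) =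
    2 * cScore V₁ s * (((ρ : ℝ) + 1 - k) * ℓ * Real.log (ρ / δ) / k) by ring] at htail
  have hm : Measurable fun ω => ‖∑ j, X j ω‖ :=
    (Finset.measurable_fun_sum _ fun j _ => hXm j).norm
  set T : ℝ := √(2 * cScore V₁ s * (((ρ : ℝ) + 1 - k) * ℓ * Real.log (ρ / δ) / k)) +
    2 * qScore V₁ s * Real.log (ρ / δ) / 3
  have hcompl : μ.real {ω | T ≤ ‖∑ j, X j ω‖}ᶜ = 1 - μ.real {ω | T ≤ ‖∑ j, X j ω‖} :=
    probReal_compl_eq_one_sub (measurableSet_le measurable_const hm)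
  refine (sub_le_sub_left (htail.trans hδ') 1).trans (hcompl.symm.le.trans
    (measureReal_mono fun ω hω => ?_))
  refine (l2_opNorm_le_norm_of_entries _ (∑ j, X j ω) fun p => ?_).trans
    (not_le.1 (show ¬ T ≤ ‖∑ j, X j ω‖ from hω)).le
  rw [sketch_mul_transpose_apply V₁ V₂ hs]
  simp [hXdef, contribution]
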